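/- For $f\in\mathbb{Z}[x]$ let $\mathrm{H}(f)$, the height of $f$, be the largest absolute value of a coefficient of $f$, and for a positive integer $n$ let $$\mathrm{B}(n)=\max\{\mathrm{H}(f) : f\in\mathbb{Z}[x],\ f\mid x^n-1\}.$$ Let $\Phi_n(x)$ denote the $n$-th cyclotomic polynomial. Let $p<q$ be odd primes. Then $$\mathrm{B}(pq^4)=\max\{\,p\,\mathrm{H}(\Phi_{pq}(x)\Phi_{pq^2}(x)\Phi_{q^3}(x)),\ p\,\mathrm{H}(\Phi_{pq}(x)\Phi_{q^2}(x))\,\}$$ and $$\mathrm{B}(pq^5)=p\,\bigl(\mathrm{H}(\Phi_{pq}(x)\Phi_{q^2}(x))\bigr)^2.$$ -/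

import Mathlib

open Polynomial

/-- The height of an integral polynomial: the largest absolute value of its coefficients
(`0` for the zero polynomial). -/
def polyHeight (f : ℤ[X]) : ℕ :=
  f.support.sup fun i => (f.coeff i).natAbs

/-- The set of heights of the divisors of `x ^ n - 1` in `ℤ[x]`. -/
def divisorHeights (n : ℕ) : Set ℕ :=
  {h | ∃ f : ℤ[X], f ∣ X ^ n - 1 ∧ polyHeight f = h}

/-- `B(n)`: the maximal height of a divisor of `x ^ n - 1` in `ℤ[x]`. For `0 < n` the supremum is
attained, see `isGreatest_maxDivisorHeight`. -/
noncomputable def maxDivisorHeight (n : ℕ) : ℕ :=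
  sSup (divisorHeights n)

/-- Every coefficient is bounded by the height. -/
theorem natAbs_coeff_le_polyHeight (f : ℤ[X]) (i : ℕ) : (f.coeff i).natAbs ≤ polyHeight f := by
  by_cases hi : i ∈ f.support
  · exact Finset.le_sup (f := fun i => (f.coeff i).natAbs) hi
  · simp [Polynomial.notMem_support_iff.mp hi]

/-- For `0 < n` only finitely many heights occur. -/
theorem finite_divisorHeights {n : ℕ} (hn : 0 < n) : (divisorHeights n).Finite := by
  have h0 : (X ^ n - 1 : ℤ[X]) ≠ 0 := (monic_X_pow_sub_C (1 : ℤ) hn.ne').ne_zero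
  have hu : Finite ℤ[X]ˣ := by
    refine Finite.of_surjective (fun u : ℤˣ => Units.map (C : ℤ →+* ℤ[X]).toMonoidHom u) ?_
    intro u
    obtain ⟨r, hr, hru⟩ := Polynomial.isUnit_iff.mp u.isUnit
    exact ⟨hr.unit, Units.ext hru⟩
  have := Fintype.ofFinite ℤ[X]ˣ
  have hfin : Finite {f : ℤ[X] // f ∣ X ^ n - 1} :=
    (UniqueFactorizationMonoid.fintypeSubtypeDvd _ h0).finite
  have : divisorHeights n
      = Set.range fun f : {f : ℤ[X] // f ∣ X ^ n - 1} => polyHeight f.1 := by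
    ext h
    simp [divisorHeights]
  rw [this]
  exact Set.finite_range _

/-- For `0 < n` the number `maxDivisorHeight n` really is the maximum. -/
theorem isGreatest_maxDivisorHeight {n : ℕ} (hn : 0 < n) :
    IsGreatest (divisorHeights n) (maxDivisorHeight n) := by
  have hb := (finite_divisorHeights hn).bddAbove
  have hne : (divisorHeights n).Nonempty := ⟨polyHeight 1, 1, one_dvd _, rfl⟩
  exact ⟨Nat.sSup_mem hne hb, fun _ h => le_csSup hb h⟩

/-!
Write `E_L = 1 + x + ⋯ + x ^ (L - 1)`, so that the coefficients of `E_L f` are the sums of the windows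
of `L` consecutive coefficients of `f`. Since `Φ_{q ^ i}` and `Φ_{p q ^ i}` are `Φ_q` and `Φ_{pq}` at
`x ^ (q ^ (i - 1))`, a divisor of `x ^ (p q ^ b) - 1` is, up to sign, a divisor `c` of `x ^ p - 1`
times a word `K₁(x) K₂(x ^ q) ⋯ K_b(x ^ (q ^ (b - 1)))` with letters `1`, `Φ_q`, `Φ_{pq}` and
`Φ_q Φ_{pq} = E_q(x ^ p)` (`exists_eq_mul_isCycloWord`). The effect of one letter on the window sums
is simple.

* If `K` is `1`, `Φ_q` or `Φ_q Φ_{pq}`, every coefficient of `K(x) f(x ^ q)` is a coefficient of `f`,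
  so a window of length `L` costs at most a factor `L`. For `Φ_q` and `L ≤ q` this factor is attained
  (`polyHeight_geom_mul_geom_mul_expand`).
* If `L < p` and `l ≡ L / q` modulo `p`, the windows of length `L` of `Φ_{pq}(x) f(x ^ q)` are the
  windows of length `l` of `f` and minus those of length `p - l`
  (`polyHeight_geom_mul_cyclotomic_mul_expand`). For `L = p` they are windows of length `p` of `f`.

Let `t` and `s` be the inverses of `q` and `q ^ 2` modulo `p`, and put `M = max t (p - t)` and
`M' = max s (p - s)`. By these rules `Φ_{pq} Φ_{q ^ 2}` has height `M` and
`Φ_{pq} Φ_{pq ^ 2} Φ_{q ^ 3}` has height `M'`. A recursion on the word length bounds the heights of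
words of length `3`, `4`, `5` by `max M M'`, `M ^ 2`, `(p - 1) M`, and, for `c = Φ_p = E_p`, the
products `c f` by `p M`, `p max M M'`, `p M ^ 2`. The last two bounds are attained.

For `c = x - 1` and `c = x ^ p - 1` the trivial factor `2` is enough when `b = 5`. When `b = 4` it
fails only for words that begin with `Φ_{pq}`. There `x ^ p - 1` is handled by
`E_p Φ_{pq} = E_p(x ^ q)`, and `x - 1` by bounding positive and negative coefficients separately
(`IsCycloWord.polyHeight_X_sub_one_mul_word_four_le`).
-/

/-! ### Heights and windows of coefficients -/

theorem polyHeight_le_iff {f : ℤ[X]} {h : ℕ} :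
    polyHeight f ≤ h ↔ ∀ n, (f.coeff n).natAbs ≤ h :=
  ⟨fun hf n => (natAbs_coeff_le_polyHeight f n).trans hf, fun hf => Finset.sup_le fun n _ => hf n⟩

theorem exists_natAbs_coeff_eq_polyHeight (f : ℤ[X]) :
    ∃ n, (f.coeff n).natAbs = polyHeight f := by
  rcases f.support.eq_empty_or_nonempty with h | h
  · exact ⟨0, by simp [polyHeight, Polynomial.support_eq_empty.mp h]⟩
  · obtain ⟨n, -, hn⟩ := Finset.exists_mem_eq_sup f.support h fun i => (f.coeff i).natAbs
    exact ⟨n, hn.symm⟩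

theorem exists_coeff_eq_zero (f : ℤ[X]) : ∃ n, f.coeff n = 0 :=
  ⟨f.natDegree + 1, coeff_eq_zero_of_natDegree_lt (Nat.lt_succ_self _)⟩

theorem polyHeight_le_of_coeff {f g : ℤ[X]} (h : ∀ n, ∃ m, f.coeff n = g.coeff m) :
    polyHeight f ≤ polyHeight g := by
  refine polyHeight_le_iff.mpr fun n => ?_
  obtain ⟨m, hm⟩ := h n
  exact hm ▸ natAbs_coeff_le_polyHeight g m

theorem polyHeight_unit_mul {u : ℤ[X]} (hu : IsUnit u) (f : ℤ[X]) :
    polyHeight (u * f) = polyHeight f := by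
  obtain ⟨r, hr, rfl⟩ := Polynomial.isUnit_iff.mp hu
  have h (n : ℕ) : ((C r * f).coeff n).natAbs = (f.coeff n).natAbs := by
    rw [coeff_C_mul, Int.natAbs_mul, Int.natAbs_of_isUnit hr, one_mul]
  refine le_antisymm (polyHeight_le_iff.mpr fun n => ?_) (polyHeight_le_iff.mpr fun n => ?_)
  · exact h n ▸ natAbs_coeff_le_polyHeight f n
  · exact h n ▸ natAbs_coeff_le_polyHeight (C r * f) n

theorem polyHeight_expand_le {q : ℕ} (hq : 0 < q) (f : ℤ[X]) :
    polyHeight (expand ℤ q f) ≤ polyHeight f := by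
  refine polyHeight_le_iff.mpr fun n => ?_
  rw [coeff_expand hq]
  split_ifs
  · exact natAbs_coeff_le_polyHeight f _
  · simp

theorem polyHeight_X_pow_sub_one_mul_le (k : ℕ) (f : ℤ[X]) :
    polyHeight ((X ^ k - 1) * f) ≤ 2 * polyHeight f := by
  refine polyHeight_le_iff.mpr fun n => ?_
  rw [sub_mul, one_mul, coeff_sub, coeff_X_pow_mul']
  have h1 := natAbs_coeff_le_polyHeight f n
  have h2 := natAbs_coeff_le_polyHeight f (n - k)
  split_ifs <;> omega

/-- The polynomial `1 + x + ⋯ + x ^ (L - 1)`. The coefficients of `geom L * f` are the sums of `L`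
consecutive coefficients of `f`. -/
noncomputable def geom (L : ℕ) : ℤ[X] :=
  ∑ i ∈ Finset.range L, X ^ i

theorem geom_one : geom 1 = 1 := by simp [geom]

theorem geom_mul_X_sub_one (L : ℕ) : geom L * (X - 1) = X ^ L - 1 :=
  geom_sum_mul X L

theorem expand_geom_mul (k L : ℕ) : expand ℤ k (geom L) * (X ^ k - 1) = X ^ (k * L) - 1 := by
  have h := congrArg (expand ℤ k) (geom_mul_X_sub_one L)
  simpa [pow_mul] using h

theorem coeff_geom_mul (L : ℕ) (f : ℤ[X]) (n : ℕ) :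
    (geom L * f).coeff n = ∑ i ∈ Finset.range L, if i ≤ n then f.coeff (n - i) else 0 := by
  simp only [geom, Finset.sum_mul, finsetSum_coeff, coeff_X_pow_mul']

theorem coeff_geom_mul_mem_Icc {f : ℤ[X]} {a b : ℤ} (ha : a ≤ 0) (hb : 0 ≤ b)
    (hf : ∀ n, f.coeff n ∈ Set.Icc a b) (L n : ℕ) :
    (geom L * f).coeff n ∈ Set.Icc (L * a) (L * b) := by
  rw [coeff_geom_mul]
  have h (i : ℕ) : (if i ≤ n then f.coeff (n - i) else 0) ∈ Set.Icc a b := by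
    split_ifs
    · exact hf _
    · exact ⟨ha, hb⟩
  constructor
  · simpa using Finset.card_nsmul_le_sum (Finset.range L) _ a fun i _ => (h i).1
  · simpa using Finset.sum_le_card_nsmul (Finset.range L) _ b fun i _ => (h i).2

theorem polyHeight_geom_mul_le (L : ℕ) (f : ℤ[X]) :
    polyHeight (geom L * f) ≤ L * polyHeight f := by
  refine polyHeight_le_iff.mpr fun n => ?_
  have h := coeff_geom_mul_mem_Icc (f := f) (a := -polyHeight f) (b := polyHeight f) (by simp)
    (by simp) (fun n => ?_) L n
  · obtain ⟨h1, h2⟩ := h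
    zify
    rw [abs_le]
    exact ⟨by linarith, h2⟩
  · have := natAbs_coeff_le_polyHeight f n
    constructor <;> omega

theorem polyHeight_one : polyHeight 1 = 1 := by
  refine le_antisymm (polyHeight_le_iff.mpr fun n => ?_) ?_
  · rw [coeff_one]
    split_ifs <;> simp
  · simpa using natAbs_coeff_le_polyHeight 1 0

theorem coeff_geom_mem_Icc (L n : ℕ) : (geom L).coeff n ∈ Set.Icc (0 : ℤ) 1 := by
  simp only [geom, finsetSum_coeff, coeff_X_pow]
  rw [Finset.sum_ite_eq]
  split_ifs <;> simp

theorem polyHeight_geom_le (L : ℕ) : polyHeight (geom L) ≤ 1 := by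
  refine polyHeight_le_iff.mpr fun n => ?_
  obtain ⟨h1, h2⟩ := coeff_geom_mem_Icc L n
  omega

theorem polyHeight_X_sub_one_mul_le {f : ℤ[X]} {a b : ℤ} {h : ℕ} (ha : a ≤ 0) (hb : 0 ≤ b)
    (hf : ∀ n, f.coeff n ∈ Set.Icc a b) (hab : b - a ≤ h) : polyHeight ((X ^ 1 - 1) * f) ≤ h := by
  refine polyHeight_le_iff.mpr fun n => ?_
  rw [sub_mul, one_mul, coeff_sub, coeff_X_pow_mul']
  obtain ⟨h1, h2⟩ := hf n
  obtain ⟨h3, h4⟩ := hf (n - 1)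
  split_ifs <;> omega

theorem polyHeight_X_sub_one_mul_expand_le {q : ℕ} (hq : 1 < q) (f : ℤ[X]) :
    polyHeight ((X - 1) * expand ℤ q f) ≤ polyHeight f := by
  refine polyHeight_le_iff.mpr fun n => ?_
  rw [← pow_one X, sub_mul, one_mul, coeff_sub, coeff_X_pow_mul', coeff_expand (by omega),
    coeff_expand (by omega)]
  have h1 := natAbs_coeff_le_polyHeight f (n / q)
  have h2 := natAbs_coeff_le_polyHeight f ((n - 1) / q)
  by_cases hn : q ∣ n
  · have : ¬ (1 ≤ n ∧ q ∣ n - 1) := by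
      rintro ⟨hle, hd⟩
      have := (Nat.dvd_sub_iff_right hle hn).mp hd
      exact hq.ne' (Nat.dvd_one.mp this)
    rw [if_pos hn]
    split_ifs with h3 h4
    · exact absurd ⟨h3, h4⟩ this
    all_goals omega
  · rw [if_neg hn]
    split_ifs <;> omega

/-! ### Polynomials given by their sections modulo `q` -/

/-- If the exponents `aᵢ` are distinct modulo `q`, the summands of `∑ x ^ aᵢ Gᵢ(x ^ q)` do not
overlap. -/
theorem coeff_sum_X_pow_mul_expand {ι : Type*} {s : Finset ι} {q : ℕ} (hq : 0 < q) {a : ι → ℕ}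
    (ha : ∀ i ∈ s, ∀ j ∈ s, a i ≡ a j [MOD q] → i = j) (G : ι → ℤ[X]) {i : ι} (hi : i ∈ s)
    (m : ℕ) : (∑ i ∈ s, X ^ a i * expand ℤ q (G i)).coeff (a i + q * m) = (G i).coeff m := by
  rw [finsetSum_coeff, Finset.sum_eq_single i]
  · rw [add_comm, coeff_X_pow_mul, mul_comm, coeff_expand_mul hq]
  · intro j hj hji
    rw [coeff_X_pow_mul']
    split_ifs with h
    · rw [coeff_expand hq, if_neg]
      intro hd
      refine hji (ha j hj i hi ?_)
      have h1 : a j ≡ a i + q * m [MOD q] := (Nat.modEq_iff_dvd' h).mpr hd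
      exact h1.trans (by simp [Nat.ModEq])
    · rfl
  · exact fun h => absurd hi h

theorem coeff_sum_X_pow_mul_expand_eq {ι : Type*} {s : Finset ι} {q : ℕ} (hq : 0 < q) {a : ι → ℕ}
    (ha : ∀ i ∈ s, ∀ j ∈ s, a i ≡ a j [MOD q] → i = j) (G : ι → ℤ[X]) (n : ℕ) :
    (∑ i ∈ s, X ^ a i * expand ℤ q (G i)).coeff n = 0 ∨
      ∃ i ∈ s, ∃ m, (∑ i ∈ s, X ^ a i * expand ℤ q (G i)).coeff n = (G i).coeff m := by
  by_cases h : ∃ i ∈ s, ∃ m, n = a i + q * m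
  · obtain ⟨i, hi, m, rfl⟩ := h
    exact Or.inr ⟨i, hi, m, coeff_sum_X_pow_mul_expand hq ha G hi m⟩
  · left
    rw [finsetSum_coeff]
    refine Finset.sum_eq_zero fun j hj => ?_
    rw [coeff_X_pow_mul']
    split_ifs with hle
    · rw [coeff_expand hq, if_neg]
      rintro ⟨m, hm⟩
      exact h ⟨j, hj, m, by omega⟩
    · rfl

theorem exists_coeff_geom_expand_mul_expand {q k : ℕ} (hq : 0 < q) (hk : k.Coprime q) (f : ℤ[X])
    (n : ℕ) : ∃ m, (expand ℤ k (geom q) * expand ℤ q f).coeff n = f.coeff m := by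
  have h : expand ℤ k (geom q) * expand ℤ q f
      = ∑ i ∈ Finset.range q, X ^ (k * i) * expand ℤ q f := by
    simp [geom, Finset.sum_mul, pow_mul]
  have ha : ∀ i ∈ Finset.range q, ∀ j ∈ Finset.range q, k * i ≡ k * j [MOD q] → i = j := by
    intro i hi j hj hij
    have h1 : i ≡ j [MOD q] := Nat.ModEq.cancel_left_of_coprime hk.symm hij
    exact h1.eq_of_lt_of_lt (Finset.mem_range.mp hi) (Finset.mem_range.mp hj)
  rw [h]
  rcases coeff_sum_X_pow_mul_expand_eq hq ha (fun _ => f) n with h0 | ⟨i, -, m, hm⟩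
  · rw [h0]
    obtain ⟨m, hm⟩ := exists_coeff_eq_zero f
    exact ⟨m, hm.symm⟩
  · exact ⟨m, hm⟩

theorem polyHeight_geom_mul_geom_mul_expand {q L : ℕ} (hL : 0 < L) (hLq : L ≤ q) (f : ℤ[X]) :
    polyHeight (geom L * (geom q * expand ℤ q f)) = L * polyHeight f := by
  have hq : 0 < q := hL.trans_le hLq
  refine le_antisymm ((polyHeight_geom_mul_le L _).trans (Nat.mul_le_mul_left L ?_)) ?_
  · refine polyHeight_le_of_coeff fun n => ?_
    simpa using exists_coeff_geom_expand_mul_expand hq (Nat.coprime_one_left q) f n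
  · obtain ⟨m, hm⟩ := exists_natAbs_coeff_eq_polyHeight f
    -- The window of length `L` ending at `q * m + (L - 1)` lies in one block of equal coefficients.
    have hsec (j : ℕ) (hj : j < q) : (geom q * expand ℤ q f).coeff (j + q * m) = f.coeff m := by
      rw [geom, Finset.sum_mul]
      refine coeff_sum_X_pow_mul_expand hq (a := id) (fun i hi j hj hij => ?_) (fun _ => f)
        (Finset.mem_range.mpr hj) m
      exact hij.eq_of_lt_of_lt (Finset.mem_range.mp hi) (Finset.mem_range.mp hj)
    have hw : (geom L * (geom q * expand ℤ q f)).coeff (L - 1 + q * m) = L * f.coeff m := by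
      rw [coeff_geom_mul]
      have : ∀ i ∈ Finset.range L, (if i ≤ L - 1 + q * m then
          (geom q * expand ℤ q f).coeff (L - 1 + q * m - i) else 0) = f.coeff m := by
        intro i hi
        have hi := Finset.mem_range.mp hi
        rw [if_pos (by omega), show L - 1 + q * m - i = (L - 1 - i) + q * m by omega]
        exact hsec _ (by omega)
      rw [Finset.sum_congr rfl this]
      simp
    have := natAbs_coeff_le_polyHeight (geom L * (geom q * expand ℤ q f)) (L - 1 + q * m)
    rwa [hw, Int.natAbs_mul, Int.natAbs_natCast, hm] at this

/-! ### The cyclotomic polynomial of index `p * q` -/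

theorem geom_eq_cyclotomic {q : ℕ} (hq : q.Prime) : geom q = cyclotomic q ℤ := by
  have := Fact.mk hq
  rw [cyclotomic_prime, geom]

theorem cyclotomic_sq_eq_expand_geom {q : ℕ} (hq : q.Prime) : cyclotomic (q ^ 2) ℤ = expand ℤ q (geom q) := by
  rw [geom_eq_cyclotomic hq, cyclotomic_expand_eq_cyclotomic hq dvd_rfl, sq]

theorem cyclotomic_mul_cyclotomic_prime {p q : ℕ} (hp : p.Prime) (hq : q.Prime) (hpq : p < q) :
    cyclotomic q ℤ * cyclotomic (p * q) ℤ = expand ℤ p (geom q) := by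
  rw [geom_eq_cyclotomic hq, cyclotomic_expand_eq_cyclotomic_mul hp, mul_comm, mul_comm q p]
  exact fun h => hpq.ne ((Nat.prime_dvd_prime_iff_eq hp hq).mp h)

theorem geom_mul_cyclotomic {p q : ℕ} (hp : p.Prime) (hq : q.Prime) (hpq : p < q) :
    geom p * cyclotomic (p * q) ℤ = expand ℤ q (geom p) := by
  rw [geom_eq_cyclotomic hp, cyclotomic_expand_eq_cyclotomic_mul hq, mul_comm]
  exact fun h => hpq.ne' ((Nat.prime_dvd_prime_iff_eq hq hp).mp h)

theorem X_pow_sub_one_ne_zero {n : ℕ} (hn : 0 < n) : (X ^ n - 1 : ℤ[X]) ≠ 0 :=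
  (monic_X_pow_sub_C (1 : ℤ) hn.ne').ne_zero

theorem X_pow_mul_sub_one_eq {p q : ℕ} (hp : p.Prime) (hq : q.Prime) (hpq : p < q) :
    (X ^ (p * q) - 1 : ℤ[X]) = (X ^ p - 1) * (cyclotomic q ℤ * cyclotomic (p * q) ℤ) := by
  rw [cyclotomic_mul_cyclotomic_prime hp hq hpq, mul_comm (X ^ p - 1), expand_geom_mul]

/-- Both sides agree after multiplication by `(x ^ p - 1) * (x ^ q - 1)`. For `L = 1` this is the
classical description of the coefficients of the cyclotomic polynomial of index `p * q`. -/
theorem geom_mul_cyclotomic_eq {p q L l m : ℕ} (hp : p.Prime) (hq : q.Prime) (hpq : p < q)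
    (hl : l ≤ p) (hm : m ≤ q) (h : p * m + q * l = p * q + L) :
    geom L * cyclotomic (p * q) ℤ = expand ℤ p (geom m) * expand ℤ q (geom l)
      - X ^ L * (expand ℤ p (geom (q - m)) * expand ℤ q (geom (p - l))) := by
  have h0 : ((X ^ p - 1) * (X ^ q - 1) : ℤ[X]) ≠ 0 :=
    mul_ne_zero (X_pow_sub_one_ne_zero hp.pos) (X_pow_sub_one_ne_zero hq.pos)
  refine mul_right_cancel₀ h0 ?_
  obtain ⟨m', rfl⟩ := Nat.exists_eq_add_of_le hm
  obtain ⟨l', hl'⟩ := Nat.exists_eq_add_of_le hl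
  have e1 := expand_geom_mul p m
  have e2 := expand_geom_mul (m + m') l
  have e3 := expand_geom_mul p m'
  have e4 := expand_geom_mul (m + m') l'
  have e5 := geom_mul_X_sub_one L
  have e6 := geom_mul_cyclotomic hp hq hpq
  have e7 := geom_mul_X_sub_one p
  have e8 := expand_geom_mul (m + m') p
  rw [Nat.add_sub_cancel_left, show p - l = l' by omega]
  have hL : (m + m') * l = p * m' + L := by nlinarith
  have hL' : p * m = (m + m') * l' + L := by
    have : p * (m + m') = (m + m') * (l + l') := by rw [← hl', mul_comm]
    nlinarith
  calc geom L * cyclotomic (p * (m + m')) ℤ * ((X ^ p - 1) * (X ^ (m + m') - 1))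
      = (geom L * (X - 1)) * ((geom p * cyclotomic (p * (m + m')) ℤ) * (X ^ (m + m') - 1)) := by
        rw [← e7]; ring
    _ = (X ^ L - 1) * (X ^ ((m + m') * p) - 1) := by rw [e5, e6, e8]
    _ = (X ^ (p * m) - 1) * (X ^ ((m + m') * l) - 1)
        - X ^ L * ((X ^ (p * m') - 1) * (X ^ ((m + m') * l') - 1)) := by
      have : (m + m') * p = p * m' + ((m + m') * l' + L) := by nlinarith
      rw [this, hL, hL']
      ring
    _ = _ := by rw [← e1, ← e2, ← e3, ← e4]; ring

/-- The residue `l ≡ L / q` modulo `p`, together with the quotient `m`. -/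
theorem exists_mul_add_mul_eq {p q L : ℕ} (hcop : p.Coprime q) (hL : 0 < L) (hLp : L < p)
    (hq : 0 < q) : ∃ l m, 0 < l ∧ l < p ∧ p * m + q * l = p * q + L := by
  obtain ⟨h1, h2⟩ := (Nat.chineseRemainder hcop L 0).2
  have h3 := Nat.chineseRemainder_lt_mul hcop L 0 (by omega) hq.ne'
  set k : ℕ := (Nat.chineseRemainder hcop L 0 : ℕ)
  obtain ⟨l, hl⟩ := (Nat.modEq_zero_iff_dvd).mp h2
  rw [hl] at h1 h3
  have hlp : l < p := by
    rw [mul_comm p q] at h3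
    exact lt_of_mul_lt_mul_left h3 (Nat.zero_le q)
  have hle : q * l ≤ p * q + L := h3.le.trans (Nat.le_add_right _ _)
  have h4 : q * l ≡ p * q + L [MOD p] := h1.trans (by simp [Nat.ModEq])
  obtain ⟨m, hm⟩ := (Nat.modEq_iff_dvd' hle).mp h4
  refine ⟨l, m, Nat.pos_of_ne_zero ?_, hlp, by omega⟩
  rintro rfl
  have h5 : L % p = 0 := by simpa [Nat.ModEq] using h1.symm
  rw [Nat.mod_eq_of_lt hLp] at h5
  omega

theorem pos_and_lt_of_mul_add_mul_eq {p q L l m : ℕ} (hpq : p < q) (hLp : L < p) (hl : 0 < l)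
    (hlp : l < p) (h : p * m + q * l = p * q + L) : 0 < m ∧ m < q := by
  constructor
  · by_contra! hm
    have : m = 0 := by omega
    subst this
    nlinarith
  · by_contra! hm
    nlinarith

/-- If `l ≡ L / q` modulo `p`, then `p - l ≡ (p - L) / q`. -/
theorem mul_add_mul_eq_sub {p q L l m : ℕ} (hpq : p < q) (hLp : L < p) (hl : 0 < l)
    (hlp : l < p) (h : p * m + q * l = p * q + L) :
    p * (q + 1 - m) + q * (p - l) = p * q + (p - L) := by
  obtain ⟨-, hm⟩ := pos_and_lt_of_mul_add_mul_eq hpq hLp hl hlp h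
  zify [hlp.le, hLp.le, show m ≤ q + 1 by omega] at h ⊢
  linarith

/-- The windows of length `L` of `Φ_{pq}(x) f(x ^ q)` are, up to sign, windows of `f` of length `l`
or `p - l`, where `l ≡ L / q` modulo `p`. The hypothesis `h` is this congruence together with a
name for the quotient, the number of residues modulo `q` at which the window has length `l`. -/
theorem geom_mul_cyclotomic_mul_expand_eq_sum {p q L l m : ℕ} (hp : p.Prime) (hq : q.Prime)
    (hpq : p < q) (hL : L < p) (hl : 0 < l) (hlp : l < p) (h : p * m + q * l = p * q + L)
    (f : ℤ[X]) :
    geom L * (cyclotomic (p * q) ℤ * expand ℤ q f) = ∑ i ∈ Finset.range q,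
      X ^ (if i < m then p * i else L + p * (i - m)) *
        expand ℤ q (if i < m then geom l * f else -(geom (p - l) * f)) := by
  obtain ⟨-, hmq⟩ := pos_and_lt_of_mul_add_mul_eq hpq hL hl hlp h
  rw [← mul_assoc, geom_mul_cyclotomic_eq hp hq hpq hlp.le hmq.le h]
  obtain ⟨m', rfl⟩ := Nat.exists_eq_add_of_le hmq.le
  have h1 : ∀ i ∈ Finset.range m, X ^ (if i < m then p * i else L + p * (i - m)) *
      expand ℤ (m + m') (if i < m then geom l * f else -(geom (p - l) * f))
      = X ^ (p * i) * expand ℤ (m + m') (geom l * f) := by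
    intro i hi
    rw [if_pos (Finset.mem_range.mp hi), if_pos (Finset.mem_range.mp hi)]
  rw [Finset.sum_range_add, Finset.sum_congr rfl h1]
  simp only [show ∀ i, ¬ (m + i < m) by omega, if_false, Nat.add_sub_cancel_left,
    ← Finset.sum_mul, pow_add, ← Finset.mul_sum]
  simp only [geom, map_sum, map_pow, expand_X, ← pow_mul, map_mul, map_neg]
  ring

/-- The exponents in `geom_mul_cyclotomic_mul_expand_eq_sum` are congruent to `p * i`. -/
theorem modEq_injOn_of_mul_add_mul_eq {p q L l m : ℕ} (hcop : p.Coprime q)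
    (h : p * m + q * l = p * q + L) :
    ∀ i ∈ Finset.range q, ∀ j ∈ Finset.range q,
      (if i < m then p * i else L + p * (i - m)) ≡ (if j < m then p * j else L + p * (j - m))
        [MOD q] → i = j := by
  have key (i : ℕ) : (if i < m then p * i else L + p * (i - m)) ≡ p * i [MOD q] := by
    split_ifs with hi
    · rfl
    · obtain ⟨k, rfl⟩ := Nat.exists_eq_add_of_le (not_lt.mp hi)
      rw [Nat.add_sub_cancel_left]
      have : L + p * k + q * p = p * (m + k) + q * l := by linarith
      have h2 : L + p * k + q * p ≡ L + p * k [MOD q] := by simp [Nat.ModEq]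
      have h3 : p * (m + k) + q * l ≡ p * (m + k) [MOD q] := by simp [Nat.ModEq]
      exact h2.symm.trans (this ▸ h3)
  intro i hi j hj hij
  have h1 : i ≡ j [MOD q] :=
    Nat.ModEq.cancel_left_of_coprime hcop.symm ((key i).symm.trans (hij.trans (key j)))
  exact h1.eq_of_lt_of_lt (Finset.mem_range.mp hi) (Finset.mem_range.mp hj)

theorem coeff_geom_mul_cyclotomic_mul_expand {p q L l m : ℕ} (hp : p.Prime) (hq : q.Prime)
    (hpq : p < q) (hL : L < p) (hl : 0 < l) (hlp : l < p) (h : p * m + q * l = p * q + L)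
    (f : ℤ[X]) (n : ℕ) :
    (∃ k, (geom L * (cyclotomic (p * q) ℤ * expand ℤ q f)).coeff n = (geom l * f).coeff k) ∨
      ∃ k, (geom L * (cyclotomic (p * q) ℤ * expand ℤ q f)).coeff n
        = -(geom (p - l) * f).coeff k := by
  have hcop : p.Coprime q := (Nat.coprime_primes hp hq).mpr hpq.ne
  rw [geom_mul_cyclotomic_mul_expand_eq_sum hp hq hpq hL hl hlp h]
  rcases coeff_sum_X_pow_mul_expand_eq hq.pos (modEq_injOn_of_mul_add_mul_eq hcop h)
    (fun i => if i < m then geom l * f else -(geom (p - l) * f)) n with h0 | ⟨i, -, k, hk⟩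
  · left
    rw [h0]
    obtain ⟨k, hk⟩ := exists_coeff_eq_zero (geom l * f)
    exact ⟨k, hk.symm⟩
  · rw [hk]
    split_ifs with hi
    · exact Or.inl ⟨k, rfl⟩
    · exact Or.inr ⟨k, by rw [coeff_neg]⟩

theorem polyHeight_geom_mul_cyclotomic_mul_expand {p q L l m : ℕ} (hp : p.Prime) (hq : q.Prime)
    (hpq : p < q) (hL : L < p) (hl : 0 < l) (hlp : l < p) (h : p * m + q * l = p * q + L)
    (f : ℤ[X]) :
    polyHeight (geom L * (cyclotomic (p * q) ℤ * expand ℤ q f))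
      = max (polyHeight (geom l * f)) (polyHeight (geom (p - l) * f)) := by
  refine le_antisymm (polyHeight_le_iff.mpr fun n => ?_) (max_le ?_ ?_)
  · rcases coeff_geom_mul_cyclotomic_mul_expand hp hq hpq hL hl hlp h f n with ⟨k, hk⟩ | ⟨k, hk⟩
    · exact hk ▸ (natAbs_coeff_le_polyHeight _ k).trans (le_max_left _ _)
    · rw [hk, Int.natAbs_neg]
      exact (natAbs_coeff_le_polyHeight _ k).trans (le_max_right _ _)
  all_goals
    obtain ⟨hm, hmq⟩ := pos_and_lt_of_mul_add_mul_eq hpq hL hl hlp h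
    have hcop : p.Coprime q := (Nat.coprime_primes hp hq).mpr hpq.ne
    have hsec (i : ℕ) (hi : i < q) (k : ℕ) :=
      coeff_sum_X_pow_mul_expand hq.pos (modEq_injOn_of_mul_add_mul_eq hcop h)
        (fun i => if i < m then geom l * f else -(geom (p - l) * f)) (Finset.mem_range.mpr hi) k
    simp only [← geom_mul_cyclotomic_mul_expand_eq_sum hp hq hpq hL hl hlp h] at hsec
  · refine polyHeight_le_of_coeff fun k => ⟨_, ((hsec 0 (by omega) k).trans ?_).symm⟩
    rw [if_pos hm]
  · refine polyHeight_le_iff.mpr fun k => ?_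
    have := hsec m hmq k
    rw [if_neg (lt_irrefl m), if_neg (lt_irrefl m), coeff_neg] at this
    rw [← Int.natAbs_neg, ← this]
    exact natAbs_coeff_le_polyHeight _ _

theorem polyHeight_geom_mul_cyclotomic_mul_expand_le {p q : ℕ} (hp : p.Prime) (hq : q.Prime)
    (hpq : p < q) (f : ℤ[X]) :
    polyHeight (geom p * (cyclotomic (p * q) ℤ * expand ℤ q f)) ≤ polyHeight (geom p * f) := by
  rw [← mul_assoc, geom_mul_cyclotomic hp hq hpq, ← map_mul]
  exact polyHeight_expand_le hq.pos _

/-! ### Divisors of `x ^ (p * q ^ b) - 1` as words -/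

theorem X_pow_sub_one_mul_letter_dvd {p q b : ℕ} {f K : ℤ[X]} (hp : p.Prime) (hq : q.Prime)
    (hpq : p < q) (hK : K ∣ cyclotomic q ℤ * cyclotomic (p * q) ℤ)
    (hf : (X ^ p - 1) * f ∣ X ^ (p * q ^ b) - 1) :
    (X ^ p - 1) * (K * expand ℤ q f) ∣ X ^ (p * q ^ (b + 1)) - 1 := by
  have h1 : (X ^ (p * q) - 1) * expand ℤ q f ∣ X ^ (p * q ^ (b + 1)) - 1 := by
    have h2 := map_dvd (expand ℤ q) hf
    simp only [map_mul, map_sub, map_pow, expand_X, map_one, ← pow_mul] at h2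
    rwa [mul_comm q p, show q * (p * q ^ b) = p * q ^ (b + 1) by ring] at h2
  refine dvd_trans ?_ h1
  rw [X_pow_mul_sub_one_eq hp hq hpq, mul_assoc]
  exact mul_dvd_mul_left _ (mul_dvd_mul_right hK _)

/-- `IsCycloWord p q b f` says that `f = K₁(x) K₂(x ^ q) ⋯ K_b(x ^ (q ^ (b - 1)))`, where each
letter `Kᵢ` is a monic divisor of `Φ_q Φ_{pq}`. Up to a sign and a divisor of `x ^ p - 1`, these
are the divisors of `x ^ (p * q ^ b) - 1`. -/
inductive IsCycloWord (p q : ℕ) : ℕ → ℤ[X] → Prop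
  | nil : IsCycloWord p q 0 1
  | one {b : ℕ} {f : ℤ[X]} : IsCycloWord p q b f → IsCycloWord p q (b + 1) (expand ℤ q f)
  | cyclo {b : ℕ} {f : ℤ[X]} : IsCycloWord p q b f →
      IsCycloWord p q (b + 1) (geom q * expand ℤ q f)
  | cycloExpand {b : ℕ} {f : ℤ[X]} : IsCycloWord p q b f →
      IsCycloWord p q (b + 1) (expand ℤ p (geom q) * expand ℤ q f)
  | cycloMul {b : ℕ} {f : ℤ[X]} : IsCycloWord p q b f →
      IsCycloWord p q (b + 1) (cyclotomic (p * q) ℤ * expand ℤ q f)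

namespace IsCycloWord

variable {p q b : ℕ} {f : ℤ[X]}

theorem X_pow_sub_one_mul_dvd (hp : p.Prime) (hq : q.Prime) (hpq : p < q)
    (hf : IsCycloWord p q b f) : (X ^ p - 1) * f ∣ X ^ (p * q ^ b) - 1 := by
  induction hf with
  | nil => simp
  | one _ ih =>
    simpa only [one_mul] using X_pow_sub_one_mul_letter_dvd hp hq hpq (one_dvd _) ih
  | cyclo _ ih =>
    exact X_pow_sub_one_mul_letter_dvd hp hq hpq (geom_eq_cyclotomic hq ▸ dvd_mul_right _ _) ih
  | cycloExpand _ ih =>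
    refine X_pow_sub_one_mul_letter_dvd hp hq hpq ?_ ih
    rw [cyclotomic_mul_cyclotomic_prime hp hq hpq]
  | cycloMul _ ih => exact X_pow_sub_one_mul_letter_dvd hp hq hpq (dvd_mul_left _ _) ih

theorem append (hf : IsCycloWord p q b f) {K : ℤ[X]} (hK : IsCycloWord p q 1 K) :
    IsCycloWord p q (b + 1) (f * expand ℤ (q ^ b) K) := by
  induction hf with
  | nil => simpa using hK
  | @one b f _ ih =>
    convert ih.one using 1
    simp [← expand_mul, pow_succ']
  | @cyclo b f _ ih =>
    convert ih.cyclo using 1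
    simp [← expand_mul, pow_succ', mul_assoc]
  | @cycloExpand b f _ ih =>
    convert ih.cycloExpand using 1
    simp [← expand_mul, pow_succ', mul_assoc]
  | @cycloMul b f _ ih =>
    convert ih.cycloMul using 1
    simp [← expand_mul, pow_succ', mul_assoc]

end IsCycloWord

theorem exists_eq_of_dvd_mul_irreducible {f g π ρ : ℤ[X]} (hπ : Irreducible π)
    (hρ : Irreducible ρ) (h : f ∣ g * (π * ρ)) :
    ∃ u g' K, IsUnit u ∧ g' ∣ g ∧ (K = 1 ∨ K = π ∨ K = ρ ∨ K = π * ρ) ∧ f = u * (g' * K) := by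
  have key {a σ : ℤ[X]} (hσ : Irreducible σ) (ha : a ∣ σ) :
      ∃ u K, IsUnit u ∧ (K = 1 ∨ K = σ) ∧ a = u * K := by
    rcases hσ.dvd_iff.mp ha with hu | ⟨u, rfl⟩
    · exact ⟨a, 1, hu, Or.inl rfl, (mul_one a).symm⟩
    · exact ⟨u, σ, u.isUnit, Or.inr rfl, mul_comm _ _⟩
  obtain ⟨g', a, hg', ha, rfl⟩ := exists_dvd_and_dvd_of_dvd_mul h
  obtain ⟨d, c, hd, hc, rfl⟩ := exists_dvd_and_dvd_of_dvd_mul ha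
  obtain ⟨u, K, hu, hK, rfl⟩ := key hπ hd
  obtain ⟨v, K', hv, hK', rfl⟩ := key hρ hc
  refine ⟨u * v, g', K * K', hu.mul hv, hg', ?_, by ring⟩
  rcases hK with rfl | rfl <;> rcases hK' with rfl | rfl <;> simp

theorem expand_pow_cyclotomic {q n : ℕ} (hq : q.Prime) (hn : q ∣ n) (b : ℕ) :
    expand ℤ (q ^ b) (cyclotomic n ℤ) = cyclotomic (n * q ^ b) ℤ := by
  induction b with
  | zero => simp
  | succ b ih =>
    rw [pow_succ', expand_mul, ih, cyclotomic_expand_eq_cyclotomic hq (hn.mul_right _)]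
    congr 1
    ring

theorem exists_eq_mul_isCycloWord {p q b : ℕ} (hp : p.Prime) (hq : q.Prime) (hpq : p < q)
    {f : ℤ[X]} (hf : f ∣ X ^ (p * q ^ b) - 1) :
    ∃ u c g, IsUnit u ∧ (c = 1 ∨ c = X ^ 1 - 1 ∨ c = geom p ∨ c = X ^ p - 1) ∧
      IsCycloWord p q b g ∧ f = u * (c * g) := by
  induction b generalizing f with
  | zero =>
    have h1 : Irreducible (X - 1 : ℤ[X]) := irreducible_X_sub_C 1
    have h2 : Irreducible (geom p) := geom_eq_cyclotomic hp ▸ cyclotomic.irreducible hp.pos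
    have h3 : X ^ (p * q ^ 0) - 1 = (1 : ℤ[X]) * ((X - 1) * geom p) := by
      rw [pow_zero, mul_one, one_mul, mul_comm, geom_mul_X_sub_one]
    obtain ⟨u, v, c, hu, hv, hc, rfl⟩ := exists_eq_of_dvd_mul_irreducible h1 h2 (h3 ▸ hf)
    refine ⟨u * v, c, 1, hu.mul (isUnit_of_dvd_one hv), ?_, .nil, by ring⟩
    rwa [pow_one, ← geom_mul_X_sub_one, mul_comm (geom p)]
  | succ b ih =>
    have hqb : 0 < q ^ b := pow_pos hq.pos b
    have h1 : Irreducible (expand ℤ (q ^ b) (geom q)) := by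
      rw [geom_eq_cyclotomic hq, expand_pow_cyclotomic hq dvd_rfl]
      exact cyclotomic.irreducible (Nat.mul_pos hq.pos hqb)
    have h2 : Irreducible (expand ℤ (q ^ b) (cyclotomic (p * q) ℤ)) := by
      rw [expand_pow_cyclotomic hq (dvd_mul_left q p)]
      exact cyclotomic.irreducible (Nat.mul_pos (Nat.mul_pos hp.pos hq.pos) hqb)
    have h3 : (X ^ (p * q ^ (b + 1)) - 1 : ℤ[X]) = (X ^ (p * q ^ b) - 1) *
        (expand ℤ (q ^ b) (geom q) * expand ℤ (q ^ b) (cyclotomic (p * q) ℤ)) := by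
      have := congrArg (expand ℤ (q ^ b)) (X_pow_mul_sub_one_eq hp hq hpq)
      simp only [map_mul, map_sub, map_pow, expand_X, map_one, ← pow_mul,
        ← geom_eq_cyclotomic hq] at this
      rwa [show q ^ b * (p * q) = p * q ^ (b + 1) by ring, mul_comm (q ^ b) p] at this
    obtain ⟨u, g, K, hu, hg, hK, rfl⟩ := exists_eq_of_dvd_mul_irreducible h1 h2 (h3 ▸ hf)
    obtain ⟨v, c, g, hv, hc, hw, rfl⟩ := ih hg
    have hK' : ∃ K', IsCycloWord p q 1 K' ∧ K = expand ℤ (q ^ b) K' := by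
      rcases hK with rfl | rfl | rfl | rfl
      · exact ⟨_, .one .nil, by simp⟩
      · exact ⟨_, .cyclo .nil, by simp⟩
      · exact ⟨_, .cycloMul .nil, by simp⟩
      · refine ⟨_, .cycloExpand .nil, ?_⟩
        rw [← map_mul, ← cyclotomic_mul_cyclotomic_prime hp hq hpq, geom_eq_cyclotomic hq]
        simp
    obtain ⟨K', hK', rfl⟩ := hK'
    exact ⟨u * v, c, _, hu.mul hv, hc, hw.append hK', by ring⟩

/-! ### Inverses of `q` and `q ^ 2` modulo `p` -/

/-- `t` and `s` are the inverses of `q` and of `q ^ 2` modulo `p`, normalized to lie between `0`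
and `p`; the congruences `q * t ≡ 1` and `q * s ≡ t` are stated with their quotients. -/
structure InverseResidues (p q t s : ℕ) : Prop where
  prime_p : p.Prime
  prime_q : q.Prime
  lt : p < q
  pos_t : 0 < t
  lt_t : t < p
  pos_s : 0 < s
  lt_s : s < p
  exists_t : ∃ m, p * m + q * t = p * q + 1
  exists_s : ∃ m, p * m + q * s = p * q + t

theorem exists_inverseResidues {p q : ℕ} (hp : p.Prime) (hq : q.Prime) (hpq : p < q) :
    ∃ t s, InverseResidues p q t s := by
  have hcop : p.Coprime q := (Nat.coprime_primes hp hq).mpr hpq.ne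
  obtain ⟨t, m, ht, htp, h⟩ := exists_mul_add_mul_eq hcop one_pos hp.one_lt hq.pos
  obtain ⟨s, m', hs, hsp, h'⟩ := exists_mul_add_mul_eq hcop ht htp hq.pos
  exact ⟨t, s, hp, hq, hpq, ht, htp, hs, hsp, ⟨m, h⟩, ⟨m', h'⟩⟩

namespace InverseResidues

variable {p q t s L : ℕ}

theorem exists_mul_add_mul_eq (hd : InverseResidues p q t s) (hL : 0 < L)
    (hLp : L < p) : ∃ l m, 0 < l ∧ l < p ∧ p * m + q * l = p * q + L :=
  _root_.exists_mul_add_mul_eq ((Nat.coprime_primes hd.prime_p hd.prime_q).mpr hd.lt.ne) hL hLp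
    hd.prime_q.pos

theorem pred_le_sq (hd : InverseResidues p q t s) :
    p - 1 ≤ max t (p - t) ^ 2 := by
  have htp := hd.lt_t
  have h1 : p ≤ 2 * max t (p - t) := by omega
  have h2 : 2 * max t (p - t) ≤ max t (p - t) ^ 2 + 1 := by
    simpa using two_mul_le_add_sq (max t (p - t)) 1
  omega

theorem polyHeight_cyclotomic_mul_expand (hd : InverseResidues p q t s) (f : ℤ[X]) :
    polyHeight (cyclotomic (p * q) ℤ * expand ℤ q f)
      = max (polyHeight (geom t * f)) (polyHeight (geom (p - t) * f)) := by
  obtain ⟨m, hm⟩ := hd.exists_t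
  simpa [geom_one] using polyHeight_geom_mul_cyclotomic_mul_expand hd.prime_p hd.prime_q hd.lt
    hd.prime_p.one_lt hd.pos_t hd.lt_t hm f

theorem polyHeight_cyclotomic_mul_expand_cyclotomic_mul_expand (hd : InverseResidues p q t s)
    (f : ℤ[X]) :
    polyHeight (cyclotomic (p * q) ℤ * expand ℤ q (cyclotomic (p * q) ℤ * expand ℤ q f))
      = max (polyHeight (geom s * f)) (polyHeight (geom (p - s) * f)) := by
  obtain ⟨m, hm⟩ := hd.exists_s
  have hm' := mul_add_mul_eq_sub hd.lt hd.lt_t hd.pos_s hd.lt_s hm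
  rw [hd.polyHeight_cyclotomic_mul_expand]
  obtain ⟨hp, hq, hlt, ht, htp, hs, hsp, _, _⟩ := hd
  rw [polyHeight_geom_mul_cyclotomic_mul_expand hp hq hlt htp hs hsp hm,
    polyHeight_geom_mul_cyclotomic_mul_expand hp hq hlt (by omega) (by omega) (by omega) hm',
    Nat.sub_sub_self hsp.le, max_comm (polyHeight (geom (p - s) * f)), max_self]

end InverseResidues

/-! ### Upper bounds for words -/

namespace IsCycloWord

variable {p q t s b L l m : ℕ} {f : ℤ[X]}

/-- Apart from `Φ_{pq}`, every letter `K` has the form `∑ x ^ aᵢ` with exponents that are distinct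
modulo `q`, so multiplying `g(x ^ q)` by `K` only repeats coefficients of `g`. -/
theorem exists_tail (hp : p.Prime) (hq : q.Prime) (hpq : p < q) (hf : IsCycloWord p q (b + 1) f) :
    ∃ g, IsCycloWord p q b g ∧
      ((∀ n, ∃ m, f.coeff n = g.coeff m) ∨ f = cyclotomic (p * q) ℤ * expand ℤ q g) := by
  have hcop : p.Coprime q := (Nat.coprime_primes hp hq).mpr hpq.ne
  cases hf with
  | @one _ g hg =>
    refine ⟨g, hg, Or.inl fun n => ?_⟩
    rw [coeff_expand hq.pos]
    split_ifs
    · exact ⟨_, rfl⟩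
    · obtain ⟨m, hm⟩ := exists_coeff_eq_zero g
      exact ⟨m, hm.symm⟩
  | @cyclo _ g hg =>
    refine ⟨g, hg, Or.inl fun n => ?_⟩
    simpa using exists_coeff_geom_expand_mul_expand hq.pos (Nat.coprime_one_left q) g n
  | @cycloExpand _ g hg =>
    exact ⟨g, hg, Or.inl (exists_coeff_geom_expand_mul_expand hq.pos hcop g)⟩
  | @cycloMul _ g hg => exact ⟨g, hg, Or.inr rfl⟩

theorem polyHeight_geom_mul_le (hp : p.Prime) (hq : q.Prime) (hpq : p < q) {h₀ h₁ : ℕ}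
    (hL : L < p) (hl : 0 < l) (hlp : l < p) (h : p * m + q * l = p * q + L)
    (hh₀ : ∀ g, IsCycloWord p q b g → polyHeight g ≤ h₀)
    (hh₁ : ∀ g, IsCycloWord p q b g → polyHeight (geom l * g) ≤ h₁)
    (hh₁' : ∀ g, IsCycloWord p q b g → polyHeight (geom (p - l) * g) ≤ h₁)
    (hf : IsCycloWord p q (b + 1) f) : polyHeight (geom L * f) ≤ max (L * h₀) h₁ := by
  obtain ⟨g, hg, hfg | rfl⟩ := hf.exists_tail hp hq hpq
  · refine le_max_of_le_left ((_root_.polyHeight_geom_mul_le L f).trans ?_)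
    exact Nat.mul_le_mul_left L ((polyHeight_le_of_coeff hfg).trans (hh₀ g hg))
  · rw [polyHeight_geom_mul_cyclotomic_mul_expand hp hq hpq hL hl hlp h]
    exact le_max_of_le_right (max_le (hh₁ g hg) (hh₁' g hg))

theorem polyHeight_le (hp : p.Prime) (hq : q.Prime) (hpq : p < q) {h₀ h₁ : ℕ}
    (hl : 0 < l) (hlp : l < p) (h : p * m + q * l = p * q + 1)
    (hh₀ : ∀ g, IsCycloWord p q b g → polyHeight g ≤ h₀)
    (hh₁ : ∀ g, IsCycloWord p q b g → polyHeight (geom l * g) ≤ h₁)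
    (hh₁' : ∀ g, IsCycloWord p q b g → polyHeight (geom (p - l) * g) ≤ h₁)
    (hf : IsCycloWord p q (b + 1) f) : polyHeight f ≤ max h₀ h₁ := by
  simpa [geom_one] using
    polyHeight_geom_mul_le (L := 1) hp hq hpq hp.one_lt hl hlp h hh₀ hh₁ hh₁' hf

theorem polyHeight_geom_prime_mul_le (hp : p.Prime) (hq : q.Prime) (hpq : p < q) {h₀ h₁ : ℕ}
    (hh₀ : ∀ g, IsCycloWord p q b g → polyHeight g ≤ h₀)
    (hh₁ : ∀ g, IsCycloWord p q b g → polyHeight (geom p * g) ≤ h₁)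
    (hf : IsCycloWord p q (b + 1) f) : polyHeight (geom p * f) ≤ max (p * h₀) h₁ := by
  obtain ⟨g, hg, hfg | rfl⟩ := hf.exists_tail hp hq hpq
  · refine le_max_of_le_left ((_root_.polyHeight_geom_mul_le p f).trans ?_)
    exact Nat.mul_le_mul_left p ((polyHeight_le_of_coeff hfg).trans (hh₀ g hg))
  · exact le_max_of_le_right
      ((polyHeight_geom_mul_cyclotomic_mul_expand_le hp hq hpq g).trans (hh₁ g hg))

theorem eq_one (hf : IsCycloWord p q 0 f) : f = 1 := by
  cases hf
  rfl

theorem polyHeight_geom_mul_le_one (L : ℕ) (hf : IsCycloWord p q 0 f) :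
    polyHeight (geom L * f) ≤ 1 := by
  rw [hf.eq_one, mul_one]
  exact polyHeight_geom_le L

theorem polyHeight_word_one_le (hd : InverseResidues p q t s) (hf : IsCycloWord p q 1 f) :
    polyHeight f ≤ 1 := by
  obtain ⟨m, hm⟩ := hd.exists_t
  simpa using polyHeight_le (h₀ := 1) (h₁ := 1) hd.prime_p hd.prime_q hd.lt hd.pos_t hd.lt_t hm
    (fun g hg => hg.eq_one ▸ polyHeight_one.le) (fun g hg => hg.polyHeight_geom_mul_le_one _)
    (fun g hg => hg.polyHeight_geom_mul_le_one _) hf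

theorem polyHeight_geom_mul_word_one_le (hd : InverseResidues p q t s) (L : ℕ)
    (hf : IsCycloWord p q 1 f) : polyHeight (geom L * f) ≤ L := by
  have h := Nat.mul_le_mul_left L (hf.polyHeight_word_one_le hd)
  exact (_root_.polyHeight_geom_mul_le L f).trans (h.trans_eq (mul_one L))

theorem polyHeight_word_two_le (hd : InverseResidues p q t s) (hf : IsCycloWord p q 2 f) :
    polyHeight f ≤ max t (p - t) := by
  obtain ⟨m, hm⟩ := hd.exists_t
  have h := polyHeight_le (h₀ := 1) (h₁ := max t (p - t)) hd.prime_p hd.prime_q hd.lt hd.pos_t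
    hd.lt_t hm (fun g hg => hg.polyHeight_word_one_le hd)
    (fun g hg => (hg.polyHeight_geom_mul_word_one_le hd _).trans (le_max_left _ _))
    (fun g hg => (hg.polyHeight_geom_mul_word_one_le hd _).trans (le_max_right _ _)) hf
  have := hd.pos_t
  omega

theorem polyHeight_geom_mul_word_two_le (hd : InverseResidues p q t s) (hL : L < p) (hl : 0 < l)
    (hlp : l < p) (h : p * m + q * l = p * q + L) (hf : IsCycloWord p q 2 f) :
    polyHeight (geom L * f) ≤ max L (max l (p - l)) := by
  have h := polyHeight_geom_mul_le (h₀ := 1) (h₁ := max l (p - l)) hd.prime_p hd.prime_q hd.lt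
    hL hl hlp h (fun g hg => hg.polyHeight_word_one_le hd)
    (fun g hg => (hg.polyHeight_geom_mul_word_one_le hd _).trans (le_max_left _ _))
    (fun g hg => (hg.polyHeight_geom_mul_word_one_le hd _).trans (le_max_right _ _)) hf
  simpa using h

theorem polyHeight_geom_mul_word_two_le_pred (hd : InverseResidues p q t s) (hL : 0 < L)
    (hLp : L < p) (hf : IsCycloWord p q 2 f) : polyHeight (geom L * f) ≤ p - 1 := by
  obtain ⟨l, m, hl, hlp, h⟩ := hd.exists_mul_add_mul_eq hL hLp
  exact (hf.polyHeight_geom_mul_word_two_le hd hLp hl hlp h).trans (by omega)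

theorem polyHeight_word_three_le (hd : InverseResidues p q t s) (hf : IsCycloWord p q 3 f) :
    polyHeight f ≤ max (max t (p - t)) (max s (p - s)) := by
  obtain ⟨m, hm⟩ := hd.exists_t
  obtain ⟨m', hm'⟩ := hd.exists_s
  have hm'' := mul_add_mul_eq_sub hd.lt hd.lt_t hd.pos_s hd.lt_s hm'
  have ht := hd.pos_t
  have htp := hd.lt_t
  have hs := hd.pos_s
  have hsp := hd.lt_s
  have h := polyHeight_le (h₀ := max t (p - t)) (h₁ := max (max t (p - t)) (max s (p - s)))
    hd.prime_p hd.prime_q hd.lt ht htp hm (fun g hg => hg.polyHeight_word_two_le hd)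
    (fun g hg => (hg.polyHeight_geom_mul_word_two_le hd htp hs hsp hm').trans (by omega))
    (fun g hg => (hg.polyHeight_geom_mul_word_two_le hd (by omega) (by omega) (by omega)
      hm'').trans (by omega)) hf
  omega

theorem polyHeight_geom_mul_word_three_le (hd : InverseResidues p q t s) (hL : 0 < L)
    (hLp : L < p) (hf : IsCycloWord p q 3 f) :
    polyHeight (geom L * f) ≤ max (L * max t (p - t)) (p - 1) := by
  obtain ⟨l, m, hl, hlp, h⟩ := hd.exists_mul_add_mul_eq hL hLp
  exact polyHeight_geom_mul_le hd.prime_p hd.prime_q hd.lt hLp hl hlp h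
    (fun g hg => hg.polyHeight_word_two_le hd)
    (fun g hg => hg.polyHeight_geom_mul_word_two_le_pred hd hl hlp)
    (fun g hg => hg.polyHeight_geom_mul_word_two_le_pred hd (by omega) (by omega)) hf

theorem polyHeight_word_four_le (hd : InverseResidues p q t s) (hf : IsCycloWord p q 4 f) :
    polyHeight f ≤ max t (p - t) ^ 2 := by
  obtain ⟨m, hm⟩ := hd.exists_t
  have ht := hd.pos_t
  have htp := hd.lt_t
  have hs := hd.pos_s
  have hsp := hd.lt_s
  have hM' := hd.pred_le_sq
  have h := polyHeight_le (h₀ := p - 1) (h₁ := max t (p - t) ^ 2)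
    hd.prime_p hd.prime_q hd.lt ht htp hm
    (fun g hg => (hg.polyHeight_word_three_le hd).trans (by omega))
    (fun g hg => (hg.polyHeight_geom_mul_word_three_le hd ht htp).trans (max_le ?_ hM'))
    (fun g hg => (hg.polyHeight_geom_mul_word_three_le hd (by omega) (by omega)).trans
      (max_le ?_ hM')) hf
  · exact h.trans (max_le hM' le_rfl)
  · exact sq (max t (p - t)) ▸ Nat.mul_le_mul_right _ (le_max_left _ _)
  · exact sq (max t (p - t)) ▸ Nat.mul_le_mul_right _ (le_max_right _ _)

theorem polyHeight_geom_mul_word_four_le (hd : InverseResidues p q t s) (hL : 0 < L)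
    (hLp : L < p) (hLt : L ≤ max t (p - t)) (hf : IsCycloWord p q 4 f) :
    polyHeight (geom L * f) ≤ (p - 1) * max t (p - t) := by
  obtain ⟨l, m, hl, hlp, h⟩ := hd.exists_mul_add_mul_eq hL hLp
  have hM : 0 < max t (p - t) := by omega
  have key {k : ℕ} (hk : 0 < k) (hkp : k < p) (g : ℤ[X]) (hg : IsCycloWord p q 3 g) :
      polyHeight (geom k * g) ≤ (p - 1) * max t (p - t) :=
    (hg.polyHeight_geom_mul_word_three_le hd hk hkp).trans
      (max_le (Nat.mul_le_mul_right _ (by omega)) (Nat.le_mul_of_pos_right _ hM))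
  have hts := hd.lt_t
  have hs := hd.lt_s
  have ht0 := hd.pos_t
  have hs0 := hd.pos_s
  refine (polyHeight_geom_mul_le (h₀ := p - 1) (h₁ := (p - 1) * max t (p - t)) hd.prime_p
    hd.prime_q hd.lt hLp hl hlp h
    (fun g hg => (hg.polyHeight_word_three_le hd).trans (by omega))
    (key hl hlp) (key (by omega) (by omega)) hf).trans (max_le ?_ le_rfl)
  rw [mul_comm]
  exact Nat.mul_le_mul_left _ hLt

theorem polyHeight_word_five_le (hd : InverseResidues p q t s) (hf : IsCycloWord p q 5 f) :
    polyHeight f ≤ (p - 1) * max t (p - t) := by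
  obtain ⟨m, hm⟩ := hd.exists_t
  have ht := hd.pos_t
  have htp := hd.lt_t
  have hs := hd.pos_s
  have hsp := hd.lt_s
  refine (polyHeight_le (h₀ := max t (p - t) ^ 2) (h₁ := (p - 1) * max t (p - t)) hd.prime_p
    hd.prime_q hd.lt ht htp hm (fun g hg => hg.polyHeight_word_four_le hd)
    (fun g hg => hg.polyHeight_geom_mul_word_four_le hd ht htp (le_max_left _ _))
    (fun g hg => hg.polyHeight_geom_mul_word_four_le hd (by omega) (by omega)
      (le_max_right _ _)) hf).trans (max_le ?_ le_rfl)
  rw [sq]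
  exact Nat.mul_le_mul_right _ (by omega)

theorem polyHeight_geom_prime_mul_word_three_le (hd : InverseResidues p q t s)
    (hf : IsCycloWord p q 3 f) : polyHeight (geom p * f) ≤ p * max t (p - t) := by
  have ht := hd.pos_t
  have hp := hd.prime_p.pos
  have hM : 1 ≤ max t (p - t) := by omega
  have h1 (g : ℤ[X]) (hg : IsCycloWord p q 1 g) := hg.polyHeight_geom_mul_word_one_le hd p
  have h2 (g : ℤ[X]) (hg : IsCycloWord p q 2 g) :=
    polyHeight_geom_prime_mul_le hd.prime_p hd.prime_q hd.lt
      (fun g hg => hg.polyHeight_word_one_le hd) h1 hg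
  refine (polyHeight_geom_prime_mul_le hd.prime_p hd.prime_q hd.lt
    (fun g hg => hg.polyHeight_word_two_le hd) h2 hf).trans (max_le le_rfl ?_)
  rw [mul_one, max_self]
  exact Nat.le_mul_of_pos_right p hM

theorem polyHeight_geom_prime_mul_word_four_le (hd : InverseResidues p q t s)
    (hf : IsCycloWord p q 4 f) :
    polyHeight (geom p * f) ≤ p * max (max t (p - t)) (max s (p - s)) := by
  refine (polyHeight_geom_prime_mul_le hd.prime_p hd.prime_q hd.lt
    (fun g hg => hg.polyHeight_word_three_le hd)
    (fun g hg => hg.polyHeight_geom_prime_mul_word_three_le hd) hf).trans (max_le le_rfl ?_)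
  exact Nat.mul_le_mul_left p (le_max_left _ _)

/-- In the extremal case `f` is `Φ_{pq}(x) g(x ^ q)` with all coefficients of `g` equal to `0` or `1`.
Its positive coefficients are sums of `t` coefficients of `g`, its negative ones are minus sums of
`p - t` of them. -/
theorem coeff_word_two_mem_Icc (hd : InverseResidues p q t s) (hf : IsCycloWord p q 2 f) (n : ℕ) :
    f.coeff n ∈ Set.Icc (-((p - t : ℕ) : ℤ)) t := by
  have ht := hd.pos_t
  have htp := hd.lt_t
  have key {k : ℕ} {g : ℤ[X]} (hg : polyHeight g ≤ 1) :
      g.coeff k ∈ Set.Icc (-((p - t : ℕ) : ℤ)) t := by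
    have := polyHeight_le_iff.mp hg k
    constructor <;> omega
  obtain ⟨g, hg, hfg | rfl⟩ := hf.exists_tail hd.prime_p hd.prime_q hd.lt
  · obtain ⟨m, hm⟩ := hfg n
    exact hm ▸ key (hg.polyHeight_word_one_le hd)
  obtain ⟨m, hm⟩ := hd.exists_t
  have hc := coeff_geom_mul_cyclotomic_mul_expand hd.prime_p hd.prime_q hd.lt
    hd.prime_p.one_lt hd.pos_t hd.lt_t hm g n
  rw [geom_one, one_mul] at hc
  obtain ⟨e, he, hge | rfl⟩ := hg.exists_tail hd.prime_p hd.prime_q hd.lt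
  · obtain rfl := he.eq_one
    have h01 (k : ℕ) : g.coeff k ∈ Set.Icc (0 : ℤ) 1 := by
      obtain ⟨m, hm⟩ := hge k
      rw [hm, coeff_one]
      split_ifs <;> simp
    rcases hc with ⟨k, hk⟩ | ⟨k, hk⟩
    all_goals
      rw [hk]
    · obtain ⟨h1, h2⟩ := coeff_geom_mul_mem_Icc le_rfl zero_le_one h01 t k
      constructor <;> omega
    · obtain ⟨h1, h2⟩ := coeff_geom_mul_mem_Icc le_rfl zero_le_one h01 (p - t) k
      constructor <;> omega
  · -- Two letters `Φ_{pq}` in a row: the windows are again windows of the constant word.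
    refine key ?_
    rw [hd.polyHeight_cyclotomic_mul_expand_cyclotomic_mul_expand]
    exact max_le (he.polyHeight_geom_mul_le_one _) (he.polyHeight_geom_mul_le_one _)

/-- Doubling the height of `f` is too wasteful only if `f` and its tail `g` begin with `Φ_{pq}` and
with another letter. Then the coefficients of `g` lie in an interval of length `p`, and those of
`f` in the interval from `-t (p - t)` to `M ^ 2`, where `M = max t (p - t)`. Its length is
`M (p - M) + M ^ 2 = p M`. -/
theorem polyHeight_X_sub_one_mul_word_four_le (hd : InverseResidues p q t s) (hp : Odd p)
    (hf : IsCycloWord p q 4 f) :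
    polyHeight ((X ^ 1 - 1) * f) ≤ p * max (max t (p - t)) (max s (p - s)) := by
  have ht := hd.pos_t
  have htp := hd.lt_t
  have hM : 2 ≤ max t (p - t) := by
    have := hp.pos
    obtain ⟨k, rfl⟩ := hp
    have := hd.prime_p.two_le
    omega
  have h2 : polyHeight f ≤ max (max t (p - t)) (max s (p - s)) ∨ polyHeight f ≤ p - 1 →
      polyHeight ((X ^ 1 - 1) * f) ≤ p * max (max t (p - t)) (max s (p - s)) := by
    have hle := polyHeight_X_pow_sub_one_mul_le 1 f
    rintro (h | h)
    · exact hle.trans (Nat.mul_le_mul hd.prime_p.two_le h)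
    · have : p * 2 ≤ p * max (max t (p - t)) (max s (p - s)) := Nat.mul_le_mul_left p (by omega)
      omega
  obtain ⟨g, hg, hfg | rfl⟩ := hf.exists_tail hd.prime_p hd.prime_q hd.lt
  · exact h2 (Or.inl ((polyHeight_le_of_coeff hfg).trans (hg.polyHeight_word_three_le hd)))
  obtain ⟨m, hm⟩ := hd.exists_t
  have hc := coeff_geom_mul_cyclotomic_mul_expand hd.prime_p hd.prime_q hd.lt
    hd.prime_p.one_lt hd.pos_t hd.lt_t hm g
  rw [geom_one, one_mul] at hc
  obtain ⟨e, he, hge | rfl⟩ := hg.exists_tail hd.prime_p hd.prime_q hd.lt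
  · have hgI (k : ℕ) : g.coeff k ∈ Set.Icc (-((p - t : ℕ) : ℤ)) t := by
      obtain ⟨j, hj⟩ := hge k
      exact hj ▸ he.coeff_word_two_mem_Icc hd j
    have hI (L k : ℕ) := coeff_geom_mul_mem_Icc (by omega) (by omega) hgI L k
    have hM1 : (t : ℤ) ^ 2 ≤ ((max t (p - t) : ℕ) : ℤ) ^ 2 := by
      gcongr
      exact le_max_left _ _
    have hM2 : ((p - t : ℕ) : ℤ) ^ 2 ≤ ((max t (p - t) : ℕ) : ℤ) ^ 2 := by
      gcongr
      exact le_max_right _ _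
    have hM3 : ((max t (p - t) : ℕ) : ℤ) ^ 2 + t * (p - t : ℕ)
        = p * ((max t (p - t) : ℕ) : ℤ) := by
      have hps : (p : ℤ) = t + (p - t : ℕ) := by omega
      rcases le_total t (p - t) with h | h
      · rw [max_eq_right h]
        linear_combination (-((p - t : ℕ) : ℤ)) * hps
      · rw [max_eq_left h]
        linear_combination (-(t : ℤ)) * hps
    have hM4 : (p * max t (p - t) : ℕ) ≤ p * max (max t (p - t)) (max s (p - s)) :=
      Nat.mul_le_mul_left p (le_max_left _ _)
    have ht0 : (0 : ℤ) ≤ t * (p - t : ℕ) := by positivity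
    refine (polyHeight_X_sub_one_mul_le (a := -(t * (p - t : ℕ)))
      (b := ((max t (p - t) : ℕ) : ℤ) ^ 2) (by omega) (by positivity) (fun n => ?_) ?_).trans hM4
    · rcases hc n with ⟨k, hk⟩ | ⟨k, hk⟩
      all_goals
        rw [hk]
      · obtain ⟨h3, h4⟩ := hI t k
        constructor <;> nlinarith
      · obtain ⟨h3, h4⟩ := hI (p - t) k
        constructor <;> nlinarith
    · rw [Nat.cast_mul]
      linarith
  · refine h2 (Or.inr ?_)
    rw [hd.polyHeight_cyclotomic_mul_expand_cyclotomic_mul_expand]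
    have hs := hd.pos_s
    have hsp := hd.lt_s
    exact max_le (he.polyHeight_geom_mul_word_two_le_pred hd hs hsp)
      (he.polyHeight_geom_mul_word_two_le_pred hd (by omega) (by omega))

theorem polyHeight_X_pow_prime_sub_one_mul_word_four_le (hd : InverseResidues p q t s)
    (hf : IsCycloWord p q 4 f) :
    polyHeight ((X ^ p - 1) * f) ≤ p * max (max t (p - t)) (max s (p - s)) := by
  obtain ⟨g, hg, hfg | rfl⟩ := hf.exists_tail hd.prime_p hd.prime_q hd.lt
  · exact (polyHeight_X_pow_sub_one_mul_le p f).trans (Nat.mul_le_mul hd.prime_p.two_le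
      ((polyHeight_le_of_coeff hfg).trans (hg.polyHeight_word_three_le hd)))
  · have h : (X ^ p - 1) * (cyclotomic (p * q) ℤ * expand ℤ q g)
        = (X - 1) * expand ℤ q (geom p * g) := by
      rw [map_mul, ← geom_mul_cyclotomic hd.prime_p hd.prime_q hd.lt, ← geom_mul_X_sub_one]
      ring
    rw [h]
    exact (polyHeight_X_sub_one_mul_expand_le hd.prime_q.one_lt _).trans
      ((hg.polyHeight_geom_prime_mul_word_three_le hd).trans
        (Nat.mul_le_mul_left p (le_max_left _ _)))

end IsCycloWord

/-! ### Bounds for `maxDivisorHeight` -/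

theorem maxDivisorHeight_le {p q b h : ℕ} (hp : p.Prime) (hq : q.Prime) (hpq : p < q)
    (h1 : ∀ g, IsCycloWord p q b g → polyHeight g ≤ h)
    (h2 : ∀ g, IsCycloWord p q b g → polyHeight ((X ^ 1 - 1) * g) ≤ h)
    (h3 : ∀ g, IsCycloWord p q b g → polyHeight (geom p * g) ≤ h)
    (h4 : ∀ g, IsCycloWord p q b g → polyHeight ((X ^ p - 1) * g) ≤ h) :
    maxDivisorHeight (p * q ^ b) ≤ h := by
  obtain ⟨f, hf, hfh⟩ :=
    (isGreatest_maxDivisorHeight (Nat.mul_pos hp.pos (pow_pos hq.pos b))).1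
  obtain ⟨u, c, g, hu, hc, hg, rfl⟩ := exists_eq_mul_isCycloWord hp hq hpq hf
  rw [← hfh, polyHeight_unit_mul hu]
  rcases hc with rfl | rfl | rfl | rfl
  · rw [one_mul]
    exact h1 g hg
  · exact h2 g hg
  · exact h3 g hg
  · exact h4 g hg

theorem le_maxDivisorHeight {p q b : ℕ} (hp : p.Prime) (hq : q.Prime) (hpq : p < q) {g : ℤ[X]}
    (hg : IsCycloWord p q b g) : polyHeight (geom p * g) ≤ maxDivisorHeight (p * q ^ b) := by
  refine (isGreatest_maxDivisorHeight (Nat.mul_pos hp.pos (pow_pos hq.pos b))).2 ⟨_, ?_, rfl⟩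
  refine (mul_dvd_mul_right ?_ g).trans (hg.X_pow_sub_one_mul_dvd hp hq hpq)
  exact ⟨X - 1, (geom_mul_X_sub_one p).symm⟩

/-! ### Extremal divisors -/

namespace InverseResidues

variable {p q t s : ℕ}

theorem polyHeight_cyclotomic_mul_expand_geom_mul (hd : InverseResidues p q t s) (f : ℤ[X]) :
    polyHeight (cyclotomic (p * q) ℤ * expand ℤ q (geom q * expand ℤ q f))
      = max t (p - t) * polyHeight f := by
  rw [hd.polyHeight_cyclotomic_mul_expand]
  obtain ⟨_, _, hlt, ht, htp, _, _, _, _⟩ := hd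
  rw [polyHeight_geom_mul_geom_mul_expand ht (by omega),
    polyHeight_geom_mul_geom_mul_expand (by omega) (by omega), Nat.mul_max_mul_right]

theorem polyHeight_cyclotomic_mul_expand_cyclotomic_mul_expand_geom_mul
    (hd : InverseResidues p q t s) (f : ℤ[X]) :
    polyHeight (cyclotomic (p * q) ℤ *
      expand ℤ q (cyclotomic (p * q) ℤ * expand ℤ q (geom q * expand ℤ q f)))
      = max s (p - s) * polyHeight f := by
  rw [hd.polyHeight_cyclotomic_mul_expand_cyclotomic_mul_expand]
  obtain ⟨_, _, hlt, _, _, hs, hsp, _, _⟩ := hd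
  rw [polyHeight_geom_mul_geom_mul_expand hs (by omega),
    polyHeight_geom_mul_geom_mul_expand (by omega) (by omega), Nat.mul_max_mul_right]

theorem polyHeight_cyclotomic_mul_cyclotomic_sq (hd : InverseResidues p q t s) :
    polyHeight (cyclotomic (p * q) ℤ * cyclotomic (q ^ 2) ℤ) = max t (p - t) := by
  have h := hd.polyHeight_cyclotomic_mul_expand_geom_mul 1
  rwa [map_one, mul_one, ← cyclotomic_sq_eq_expand_geom hd.prime_q, polyHeight_one, mul_one] at h

theorem polyHeight_cyclotomic_mul_cyclotomic_mul_cyclotomic_cube (hd : InverseResidues p q t s) :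
    polyHeight (cyclotomic (p * q) ℤ * cyclotomic (p * q ^ 2) ℤ * cyclotomic (q ^ 3) ℤ)
      = max s (p - s) := by
  have h := hd.polyHeight_cyclotomic_mul_expand_cyclotomic_mul_expand_geom_mul 1
  have h2 : expand ℤ q (cyclotomic (p * q) ℤ) = cyclotomic (p * q ^ 2) ℤ := by
    rw [cyclotomic_expand_eq_cyclotomic hd.prime_q (dvd_mul_left q p), mul_assoc, sq]
  have h3 : expand ℤ q (cyclotomic (q ^ 2) ℤ) = cyclotomic (q ^ 3) ℤ := by
    rw [cyclotomic_expand_eq_cyclotomic hd.prime_q (dvd_pow_self q two_ne_zero), ← pow_succ]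
  rwa [map_one, mul_one, ← cyclotomic_sq_eq_expand_geom hd.prime_q, map_mul, h2, h3, polyHeight_one, mul_one,
    ← mul_assoc] at h

end InverseResidues

theorem theorem1p7 (p q : ℕ) (hp : p.Prime) (hq : q.Prime) (hp_odd : Odd p) (hq_odd : Odd q)
    (hpq : p < q) :
    maxDivisorHeight (p * q ^ 4) =
        max
          (p * polyHeight
            (cyclotomic (p * q) ℤ * cyclotomic (p * q ^ 2) ℤ * cyclotomic (q ^ 3) ℤ))
          (p * polyHeight (cyclotomic (p * q) ℤ * cyclotomic (q ^ 2) ℤ)) ∧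
      maxDivisorHeight (p * q ^ 5) =
        p * polyHeight (cyclotomic (p * q) ℤ * cyclotomic (q ^ 2) ℤ) ^ 2 := by
  obtain ⟨t, s, hd⟩ := exists_inverseResidues hp hq hpq
  rw [hd.polyHeight_cyclotomic_mul_cyclotomic_sq,
    hd.polyHeight_cyclotomic_mul_cyclotomic_mul_cyclotomic_cube, Nat.mul_max_mul_left,
    max_comm (max s _)]
  have ht := hd.pos_t
  have htp := hd.lt_t
  -- The lower bound uses that `p` is odd: for `p = 2` one has `t = p - t = 1`.
  have hM : 2 ≤ max t (p - t) ∧ max t (p - t) ≤ p := by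
    obtain ⟨k, rfl⟩ := hp_odd
    omega
  constructor
  · refine le_antisymm (maxDivisorHeight_le hp hq hpq (fun g hg => ?_)
      (fun g hg => hg.polyHeight_X_sub_one_mul_word_four_le hd hp_odd)
      (fun g hg => hg.polyHeight_geom_prime_mul_word_four_le hd)
      (fun g hg => hg.polyHeight_X_pow_prime_sub_one_mul_word_four_le hd)) ?_
    · refine (hg.polyHeight_word_four_le hd).trans ?_
      rw [sq]
      exact Nat.mul_le_mul hM.2 (le_max_left _ _)
    · rw [← Nat.mul_max_mul_left]
      refine max_le ?_ ?_
      · -- `Φ_p(x) Φ_q(x) Φ_{pq}(x ^ q) Φ_q(x ^ (q ^ 2))`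
        have h := le_maxDivisorHeight hp hq hpq (.cyclo (.cycloMul (.cyclo (.one .nil))))
        rw [polyHeight_geom_mul_geom_mul_expand hp.pos hpq.le,
          hd.polyHeight_cyclotomic_mul_expand_geom_mul, map_one,
          polyHeight_one, mul_one] at h
        exact h
      · -- `Φ_p(x) Φ_q(x) Φ_{pq}(x ^ q) Φ_{pq}(x ^ (q ^ 2)) Φ_q(x ^ (q ^ 3))`
        have h := le_maxDivisorHeight hp hq hpq (.cyclo (.cycloMul (.cycloMul (.cyclo .nil))))
        rw [polyHeight_geom_mul_geom_mul_expand hp.pos hpq.le,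
          hd.polyHeight_cyclotomic_mul_expand_cyclotomic_mul_expand_geom_mul,
          polyHeight_one, mul_one] at h
        exact h
  · have h5 : 2 * ((p - 1) * max t (p - t)) ≤ p * max t (p - t) ^ 2 := by
      have : 2 * (p - 1) ≤ p * max t (p - t) := by
        rw [mul_comm]
        exact Nat.mul_le_mul (Nat.sub_le p 1) hM.1
      rw [sq, ← mul_assoc, ← mul_assoc]
      exact Nat.mul_le_mul_right _ this
    refine le_antisymm (maxDivisorHeight_le hp hq hpq (fun g hg => ?_) (fun g hg => ?_)
      (fun g hg => ?_) (fun g hg => ?_)) ?_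
    · have := hg.polyHeight_word_five_le hd
      omega
    · have := hg.polyHeight_word_five_le hd
      have := polyHeight_X_pow_sub_one_mul_le 1 g
      omega
    · refine (IsCycloWord.polyHeight_geom_prime_mul_le hp hq hpq
        (fun g hg => hg.polyHeight_word_four_le hd)
        (fun g hg => hg.polyHeight_geom_prime_mul_word_four_le hd) hg).trans (max_le le_rfl ?_)
      have hMs : max (max t (p - t)) (max s (p - s)) ≤ max t (p - t) ^ 2 := by
        have := hd.pred_le_sq
        have := hd.pos_s
        have := hd.lt_s
        omega
      exact Nat.mul_le_mul_left p hMs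
    · have := hg.polyHeight_word_five_le hd
      have := polyHeight_X_pow_sub_one_mul_le p g
      omega
    · -- `Φ_p(x) Φ_q(x) G(x ^ q) G(x ^ (q ^ 3))` with `G(x) = Φ_{pq}(x) Φ_q(x ^ q)`
      have h := le_maxDivisorHeight hp hq hpq
        (.cyclo (.cycloMul (.cyclo (.cycloMul (.cyclo .nil)))))
      rw [polyHeight_geom_mul_geom_mul_expand hp.pos hpq.le,
        hd.polyHeight_cyclotomic_mul_expand_geom_mul,
        hd.polyHeight_cyclotomic_mul_expand_geom_mul, polyHeight_one, mul_one,
        ← sq] at h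
      exact h
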